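/- Theorem (Procesi--Schwarz, finite groups). Let $G\subseteq \mathrm{GL}_n(\mathbb{R})$ be a finite group, acting on $\mathbb{R}[X]=\mathbb{R}[X_1,\dots,X_n]$ by $h^\sigma(x)=h(\sigma^{-1}x)$, and let $\pi_1,\dots,\pi_m\in\mathbb{R}[X]$ be fundamental invariants of $G$, i.e. $\mathbb{R}[X]^G=\mathbb{R}[\pi_1,\dots,\pi_m]$. Let $$\Pi:\mathbb{R}^n\to\mathbb{R}^m,\quad x\mapsto(\pi_1(x),\dots,\pi_m(x)),$$ let $I_\Pi=\{p\in\mathbb{R}[z_1,\dots,z_m] : p(\pi_1,\dots,\pi_m)=0\}$ be the ideal of relations, and let $V(I_\Pi)\subseteq\mathbb{R}^m$ be its real zero set. Let $\langle\cdot,\cdot\rangle$ be a $G$-invariant inner product on the dual space $(\mathbb{R}^n)^*$, with $\langle dx_j,dx_k\rangle=B_{jk}$, and for polynomials $p,q$ put $$\langle dp,dq\rangle=\sum_{j,k=1}^n B_{jk}\,\frac{\partial p}{\partial x_j}\frac{\partial q}{\partial x_k}$$ (if $G$ consists of orthogonal matrices one may take $B$ to be the identity, which gives $\sum_j \frac{\partial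 p}{\partial x_j}\frac{\partial q}{\partial x_j}$). Let $M_\Pi=(\langle d\pi_i,d\pi_j\rangle)_{1\le i,j\le m}$. Then $M_\Pi$ can be written as a matrix polynomial in $\pi_1,\dots,\pi_m$, that is, there is an $m\times m$ matrix $N$ over $\mathbb{R}[z_1,\dots,z_m]$ with $N(\pi_1,\dots,\pi_m)=M_\Pi$; and for every such $N$, writing $M_\Pi(z):=N(z)$, $$\Pi(\mathbb{R}^n)=\{z\in V(I_\Pi) : M_\Pi(z)\text{ is positive semidefinite}\}.$$ -/

import Mathlib

open MvPolynomial

noncomputable section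

namespace OrbitSpace

/-- The substitution `h ↦ h(σ⁻¹ x)` on real polynomials in `n` variables. -/
def polyAct {n : ℕ} (σ : Matrix.GeneralLinearGroup (Fin n) ℝ) :
    MvPolynomial (Fin n) ℝ →ₐ[ℝ] MvPolynomial (Fin n) ℝ :=
  aeval fun i => ∑ j, C ((σ⁻¹).val i j) * X j

/-- The algebra `ℝ[X]^G` of `G`-invariant polynomials. -/
def invariants {n : ℕ} (G : Subgroup (Matrix.GeneralLinearGroup (Fin n) ℝ)) :
    Subalgebra ℝ (MvPolynomial (Fin n) ℝ) where
  carrier := {h | ∀ σ ∈ G, polyAct σ h = h}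
  mul_mem' ha hb σ hσ := by rw [map_mul, ha σ hσ, hb σ hσ]
  add_mem' ha hb σ hσ := by rw [map_add, ha σ hσ, hb σ hσ]
  algebraMap_mem' r σ _ := (polyAct σ).commutes r

/-- `π₁, …, πₘ` are fundamental invariants of `G`: `ℝ[π₁, …, πₘ] = ℝ[X]^G`. -/
def IsFundamentalInvariants {n m : ℕ} (G : Subgroup (Matrix.GeneralLinearGroup (Fin n) ℝ))
    (π : Fin m → MvPolynomial (Fin n) ℝ) : Prop :=
  Algebra.adjoin ℝ (Set.range π) = invariants G

/-- The Hilbert map `Π : ℝⁿ → ℝᵐ`, `x ↦ (π₁(x), …, πₘ(x))`. -/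
def hilbertMap {n m : ℕ} (π : Fin m → MvPolynomial (Fin n) ℝ) (x : Fin n → ℝ) : Fin m → ℝ :=
  fun i => eval x (π i)

/-- The ideal of relations of `π₁, …, πₘ`. -/
def relationIdeal {n m : ℕ} (π : Fin m → MvPolynomial (Fin n) ℝ) :
    Ideal (MvPolynomial (Fin m) ℝ) :=
  RingHom.ker (aeval π : MvPolynomial (Fin m) ℝ →ₐ[ℝ] MvPolynomial (Fin n) ℝ)

/-- `B` is the Gram matrix, in the basis `dx₁, …, dxₙ`, of an inner product on the dual space of
`ℝⁿ` that is invariant under the action of `G`. An element `σ` acts on the dual space by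
`ℓ ↦ ℓ ∘ σ⁻¹`, so that (`σ` running through a group) invariance reads `σ B σᵀ = B`.
For a group of orthogonal matrices, `B = 1` is such an inner product. -/
def IsInvariantInnerProduct {n : ℕ} (G : Subgroup (Matrix.GeneralLinearGroup (Fin n) ℝ))
    (B : Matrix (Fin n) (Fin n) ℝ) : Prop :=
  B.PosDef ∧ ∀ σ ∈ G, σ.val * B * σ.val.transpose = B

/-- `⟨dp, dq⟩`, where `dp = ∑ⱼ (∂p/∂xⱼ) dxⱼ` and `⟨dxⱼ, dxₖ⟩ = B j k`.
For `B = 1` this is `∑ⱼ (∂p/∂xⱼ) (∂q/∂xⱼ)`. -/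
def diffInner {n : ℕ} (B : Matrix (Fin n) (Fin n) ℝ) (p q : MvPolynomial (Fin n) ℝ) :
    MvPolynomial (Fin n) ℝ :=
  ∑ j, ∑ k, C (B j k) * (pderiv j p * pderiv k q)

/-- The matrix `M_Π = (⟨dπᵢ, dπⱼ⟩)` of polynomials in `x₁, …, xₙ`. -/
def gramMatrix {n m : ℕ} (B : Matrix (Fin n) (Fin n) ℝ) (π : Fin m → MvPolynomial (Fin n) ℝ) :
    Matrix (Fin m) (Fin m) (MvPolynomial (Fin n) ℝ) :=
  Matrix.of fun i j => diffInner B (π i) (π j)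

/-- `N`, a matrix of polynomials in `z₁, …, zₘ`, expresses `M_Π` as a matrix polynomial in
`π₁, …, πₘ`: `N(π₁, …, πₘ) = M_Π`. -/
def Represents {n m : ℕ} (π : Fin m → MvPolynomial (Fin n) ℝ)
    (N : Matrix (Fin m) (Fin m) (MvPolynomial (Fin m) ℝ))
    (M : Matrix (Fin m) (Fin m) (MvPolynomial (Fin n) ℝ)) : Prop :=
  N.map (aeval π) = M

end OrbitSpace

end

open MvPolynomial Matrix

namespace OrbitSpace

/-! At a real point the matrix is `J B Jᵀ`, with `J` the Jacobian of `π`, so it is positive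
semidefinite. Conversely, averaging over `G` and the Nullstellensatz lift each real `z` in the
relation variety to a complex point `x` (`exists_complex_preimage`); semidefiniteness must force `x`
to be real (`star_eq_of_posSemidef`). If it is not, let `l` be the covector `B`-dual to `Im x`.
Interpolation on the orbit gives a real polynomial whose differential is `i l` at `x`, its conjugate
at `star x`, and zero at the other orbit points. Its average is an invariant `P(π)` with
differential `i R l` at `x`, `R > 0`, so the real vector `∇P(z)` gives the quadratic form of `N(z)`
the value `-R² ⟨l, l⟩ < 0`. -/

/-- Chain rule for the formal partial derivatives. -/
theorem pderiv_aeval {R ι κ : Type*} [CommRing R] [Fintype ι]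
    (f : ι → MvPolynomial κ R) (P : MvPolynomial ι R) (j : κ) :
    pderiv j (aeval f P) = ∑ i, aeval f (pderiv i P) * pderiv j (f i) := by
  classical
  induction P using MvPolynomial.induction_on with
  | C a => simp
  | add p q hp hq => simp only [map_add, hp, hq, add_mul, Finset.sum_add_distrib]
  | mul_X p k hp =>
    simp only [map_mul, Derivation.leibniz, hp, aeval_X, pderiv_X, smul_eq_mul, map_add, add_mul,
      Finset.sum_add_distrib, Finset.mul_sum]
    congr 1
    · rw [Finset.sum_eq_single k] <;> simp +contextual [eq_comm]
    · exact Finset.sum_congr rfl fun i _ => by ring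

theorem sum_sum_comm {ι κ M : Type*} [Fintype ι] [Fintype κ] [AddCommMonoid M]
    (F : ι → ι → κ → κ → M) :
    ∑ i, ∑ j, ∑ a, ∑ b, F i j a b = ∑ a, ∑ b, ∑ i, ∑ j, F i j a b := by
  have h : ∑ p : ι × ι, ∑ q : κ × κ, F p.1 p.2 q.1 q.2
      = ∑ q : κ × κ, ∑ p : ι × ι, F p.1 p.2 q.1 q.2 := Finset.sum_comm
  simpa only [Fintype.sum_prod_type] using h

/-! ### Linear substitutions, averaging and differentials -/

section Action

variable {n : ℕ} {K : Type*} [Field K] [Algebra ℝ K]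

theorem polyAct_mul (σ τ : Matrix.GeneralLinearGroup (Fin n) ℝ) (p : MvPolynomial (Fin n) ℝ) :
    polyAct (σ * τ) p = polyAct σ (polyAct τ p) := by
  rw [← AlgHom.comp_apply]
  congr 1
  refine MvPolynomial.algHom_ext fun i => ?_
  simp only [polyAct, AlgHom.comp_apply, aeval_X, map_sum, map_mul, algHom_C, algebraMap_eq,
    _root_.mul_inv_rev, Units.val_mul, Matrix.mul_apply, Finset.sum_mul, Finset.mul_sum]
  rw [Finset.sum_comm]
  simp [mul_assoc]

theorem aeval_polyAct (σ : Matrix.GeneralLinearGroup (Fin n) ℝ) (x : Fin n → K)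
    (p : MvPolynomial (Fin n) ℝ) :
    aeval x (polyAct σ p) = aeval ((σ⁻¹).val.map (algebraMap ℝ K) *ᵥ x) p := by
  rw [← AlgHom.comp_apply]
  congr 1
  refine MvPolynomial.algHom_ext fun i => ?_
  simp [polyAct, Matrix.mulVec, dotProduct]

theorem pderiv_polyAct (σ : Matrix.GeneralLinearGroup (Fin n) ℝ) (p : MvPolynomial (Fin n) ℝ)
    (j : Fin n) :
    pderiv j (polyAct σ p) = ∑ k, C ((σ⁻¹).val k j) * polyAct σ (pderiv k p) := by
  rw [polyAct, pderiv_aeval]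
  refine Finset.sum_congr rfl fun k _ => ?_
  rw [mul_comm]
  congr 1
  simp [pderiv_X, Pi.single_apply]

/-- The sum of the translates of a polynomial under a finite group is invariant. -/
theorem sum_polyAct_mem_invariants (G : Subgroup (Matrix.GeneralLinearGroup (Fin n) ℝ))
    [Fintype G] (p : MvPolynomial (Fin n) ℝ) :
    ∑ σ : G, polyAct σ.val p ∈ invariants G := by
  intro τ hτ
  rw [map_sum]
  exact Fintype.sum_equiv (Equiv.mulLeft (⟨τ, hτ⟩ : G)) _ _ fun σ => by
    simp [polyAct_mul]

/-- By the chain rule the two differentials contribute the factors `σ⁻¹` and `σ⁻ᵀ` around `B`, and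
`hσ` absorbs them. Hence the Gram entries of invariants are invariant. -/
theorem diffInner_polyAct (B : Matrix (Fin n) (Fin n) ℝ)
    (σ : Matrix.GeneralLinearGroup (Fin n) ℝ) (hσ : (σ⁻¹).val * B * (σ⁻¹).val.transpose = B)
    (p q : MvPolynomial (Fin n) ℝ) :
    diffInner B (polyAct σ p) (polyAct σ q) = polyAct σ (diffInner B p q) := by
  have key : ∀ k l, ∑ i, ∑ j, (σ⁻¹).val k i * B i j * (σ⁻¹).val l j = B k l := fun k l => by
    conv_rhs => rw [← hσ]
    simp only [Matrix.mul_apply, Matrix.transpose_apply, Finset.sum_mul]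
    exact Finset.sum_comm
  trans ∑ k, ∑ l, C (∑ i, ∑ j, (σ⁻¹).val k i * B i j * (σ⁻¹).val l j) *
    (polyAct σ (pderiv k p) * polyAct σ (pderiv l q))
  swap
  · simp only [key, diffInner, map_sum, map_mul, algHom_C, algebraMap_eq]
  simp only [diffInner, pderiv_polyAct, map_sum, map_mul, Finset.sum_mul_sum]
  simp only [Finset.mul_sum, Finset.sum_mul]
  rw [sum_sum_comm]
  refine Finset.sum_congr rfl fun _ _ => Finset.sum_congr rfl fun _ _ =>
    Finset.sum_congr rfl fun _ _ => Finset.sum_congr rfl fun _ _ => ?_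
  ring

end Action

/-! ### Complex fibres of the Hilbert map -/

section Fibres

variable {n m : ℕ} {G : Subgroup (Matrix.GeneralLinearGroup (Fin n) ℝ)}
  {π : Fin m → MvPolynomial (Fin n) ℝ}

theorem IsFundamentalInvariants.exists_aeval_eq (hπ : IsFundamentalInvariants G π)
    {p : MvPolynomial (Fin n) ℝ} (hp : p ∈ invariants G) :
    ∃ P : MvPolynomial (Fin m) ℝ, aeval π P = p := by
  rw [← hπ, Algebra.adjoin_range_eq_range_aeval] at hp
  exact hp

theorem IsFundamentalInvariants.mem_invariants (hπ : IsFundamentalInvariants G π) (i : Fin m) :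
    π i ∈ invariants G := by
  rw [← hπ]
  exact Algebra.subset_adjoin ⟨i, rfl⟩

/-- Every real point of the variety of relations is the image of a complex point under the
Hilbert map. -/
theorem IsFundamentalInvariants.exists_complex_preimage [Finite G]
    (hπ : IsFundamentalInvariants G π) {z : Fin m → ℝ}
    (hz : z ∈ zeroLocus ℝ (relationIdeal π)) :
    ∃ x : Fin n → ℂ, ∀ i, aeval x (π i) = (z i : ℂ) := by
  have := Fintype.ofFinite G
  set J : Ideal (MvPolynomial (Fin n) ℝ) := Ideal.span (Set.range fun i => π i - C (z i)) with hJ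
  have hJtop : J ≠ ⊤ := by
    intro htop
    have h1 : (1 : MvPolynomial (Fin n) ℝ) ∈ J := htop ▸ Submodule.mem_top
    obtain ⟨c, hc⟩ := Ideal.mem_span_range_iff_exists_fun.1 h1
    choose Q hQ using fun i => hπ.exists_aeval_eq (sum_polyAct_mem_invariants G (c i))
    -- Averaging `1 = ∑ cᵢ (πᵢ - zᵢ)` over `G` gives a relation among the `πᵢ` whose value at `z` is
    -- `-|G| ≠ 0`.
    have hP : aeval π (∑ i, Q i * (X i - C (z i)) - C (Fintype.card G : ℝ)) = 0 := by
      have h2 : ∑ σ : G, polyAct σ.val (1 : MvPolynomial (Fin n) ℝ)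
          = ∑ i, (∑ σ : G, polyAct σ.val (c i)) * (π i - C (z i)) := by
        rw [← hc]
        simp only [map_sum, map_mul, Finset.sum_mul]
        rw [Finset.sum_comm]
        refine Finset.sum_congr rfl fun i _ => Finset.sum_congr rfl fun σ _ => ?_
        rw [map_sub, hπ.mem_invariants i σ.val σ.2, algHom_C, algebraMap_eq]
      simp only [map_sub, map_sum, map_mul, hQ, aeval_X, algHom_C, algebraMap_eq, ← h2]
      simp
    have := hz _ hP
    simp at this
  have : (zeroLocus ℂ J).Nonempty := by
    rw [Set.nonempty_iff_ne_empty]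
    intro he
    have h := vanishingIdeal_zeroLocus_eq_radical (K := ℂ) J
    rw [he, vanishingIdeal_empty, eq_comm, Ideal.radical_eq_top] at h
    exact hJtop h
  obtain ⟨x, hx⟩ := this
  refine ⟨x, fun i => ?_⟩
  have := hx _ (Ideal.subset_span ⟨i, rfl⟩)
  simpa [sub_eq_zero] using this

end Fibres

/-! ### Interpolation of differentials at finitely many points -/

section Interpolation

/-- A polynomial separating a point from a finite set of points. -/
theorem exists_eval_eq_one_of_notMem {K ι : Type*} [Field K] (x : ι → K) (S : Finset (ι → K))
    (hx : x ∉ S) :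
    ∃ E : MvPolynomial ι K, eval x E = 1 ∧ ∀ y ∈ S, eval y E = 0 := by
  classical
  induction S using Finset.induction_on with
  | empty => exact ⟨1, by simp⟩
  | insert y S _ ih =>
    simp only [Finset.mem_insert, not_or] at hx
    obtain ⟨E, hE, hES⟩ := ih hx.2
    obtain ⟨j, hj⟩ := Function.ne_iff.1 hx.1
    refine ⟨E * (C (x j - y j)⁻¹ * (X j - C (y j))), ?_, ?_⟩
    · simp [hE, sub_ne_zero.2 hj]
    · simp +contextual [hES]

/-- A polynomial with prescribed differential at a point and vanishing differentials at finitely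
many other points. -/
theorem exists_eval_pderiv_eq {K ι : Type*} [Field K] [Fintype ι] (x v : ι → K)
    (S : Finset (ι → K)) (hx : x ∉ S) :
    ∃ H : MvPolynomial ι K, (∀ j, eval x (pderiv j H) = v j) ∧
      ∀ y ∈ S, ∀ j, eval y (pderiv j H) = 0 := by
  classical
  obtain ⟨E, hE, hES⟩ := exists_eval_eq_one_of_notMem x S hx
  -- The square kills the differential on `S`; at `x` the linear factor vanishes, so only its own
  -- differential `v` survives.
  refine ⟨E ^ 2 * ∑ k, C (v k) * (X k - C (x k)), fun j => ?_, fun y hy j => ?_⟩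
  · simp [Derivation.leibniz, hE, pderiv_X, Pi.single_apply]
  · simp [Derivation.leibniz, hES y hy, pow_two]

theorem exists_map_eq_add_conj {ι : Type*} (H : MvPolynomial ι ℂ) :
    ∃ h : MvPolynomial ι ℝ, map (algebraMap ℝ ℂ) h = H + map (starRingEnd ℂ) H := by
  induction H using MvPolynomial.induction_on' with
  | monomial u a =>
    refine ⟨monomial u (2 * a.re), ?_⟩
    rw [map_monomial, map_monomial, ← map_add, Complex.add_conj]
    simp
  | add p q hp hq =>
    obtain ⟨h, hh⟩ := hp
    obtain ⟨k, hk⟩ := hq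
    exact ⟨h + k, by rw [map_add, map_add, hh, hk]; ring⟩

theorem eval_map_conj {ι : Type*} (x : ι → ℂ) (H : MvPolynomial ι ℂ) :
    eval x (map (starRingEnd ℂ) H) = starRingEnd ℂ (eval (star x) H) := by
  induction H using MvPolynomial.induction_on with
  | C a => simp
  | add p q hp hq => simp [hp, hq]
  | mul_X p k hp => simp [hp]

/-- A real polynomial whose differential is prescribed at a nonreal complex point (and hence at
the conjugate point) and vanishes at finitely many other points. -/
theorem exists_real_aeval_pderiv_eq {ι : Type*} [Fintype ι] (x v : ι → ℂ) (hx : star x ≠ x)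
    (S : Finset (ι → ℂ)) :
    ∃ h : MvPolynomial ι ℝ, (∀ j, aeval x (pderiv j h) = v j) ∧
      (∀ j, aeval (star x) (pderiv j h) = star (v j)) ∧
      ∀ y ∈ S, y ≠ x → y ≠ star x → ∀ j, aeval y (pderiv j h) = 0 := by
  classical
  -- The set is made stable under conjugation before `x` is removed, so that in `H` plus its
  -- conjugate only one summand contributes at `x` and at `star x`, and none at the other points.
  obtain ⟨H, hH, hHS⟩ := exists_eval_pderiv_eq x v
    ((insert x S ∪ (insert x S).image star).erase x) (by simp)
  obtain ⟨h, hh⟩ := exists_map_eq_add_conj H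
  have key : ∀ y j, aeval y (pderiv j h)
      = eval y (pderiv j H) + star (eval (star y) (pderiv j H)) := by
    intro y j
    rw [aeval_def, eval₂_eq_eval_map, ← pderiv_map, hh, map_add, map_add, pderiv_map,
      eval_map_conj]
    rfl
  have hsx : ∀ j, eval (star x) (pderiv j H) = 0 := hHS _ (by simp [hx])
  refine ⟨h, fun j => ?_, fun j => ?_, fun y hy hyx hyx' j => ?_⟩
  · rw [key, hH, hsx]; simp
  · rw [key, star_star, hH, hsx]; simp
  · rw [key, hHS y (by simp [hy, hyx]), hHS (star y) ?_]
    · simp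
    · have : star y ≠ x := fun h => hyx' (by rw [← h, star_star])
      simp [hy, this]

end Interpolation

/-! ### The Gram matrix and reality of the fibre -/

section Main

variable {n m : ℕ} {G : Subgroup (Matrix.GeneralLinearGroup (Fin n) ℝ)}
  {B : Matrix (Fin n) (Fin n) ℝ} {π : Fin m → MvPolynomial (Fin n) ℝ}

theorem aeval_diffInner {K : Type*} [Field K] [Algebra ℝ K] (x : Fin n → K)
    (p q : MvPolynomial (Fin n) ℝ) :
    aeval x (diffInner B p q) = ∑ j, ∑ k, algebraMap ℝ K (B j k) *
      (aeval x (pderiv j p) * aeval x (pderiv k q)) := by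
  simp [diffInner]

/-- The quadratic form of `N(z)` computes the inner product of differentials of invariants at any
(real or complex) point over `z`. -/
theorem Represents.algebraMap_dotProduct {K : Type*} [Field K] [Algebra ℝ K]
    {N : Matrix (Fin m) (Fin m) (MvPolynomial (Fin m) ℝ)}
    (hN : Represents π N (gramMatrix B π)) {x : Fin n → K} {z : Fin m → ℝ}
    (hx : ∀ i, aeval x (π i) = algebraMap ℝ K (z i)) (c : Fin m → ℝ) :
    algebraMap ℝ K (c ⬝ᵥ (N.map (eval z) *ᵥ c)) =
      ∑ j, ∑ k, algebraMap ℝ K (B j k) *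
        ((∑ i, algebraMap ℝ K (c i) * aeval x (pderiv j (π i))) *
          ∑ i, algebraMap ℝ K (c i) * aeval x (pderiv k (π i))) := by
  have hev : ∀ P : MvPolynomial (Fin m) ℝ, aeval x (aeval π P) = algebraMap ℝ K (eval z P) := by
    intro P
    rw [← AlgHom.comp_apply, comp_aeval]
    simp only [hx]
    exact (aeval_algebraMap_apply K z P).trans (by simp [aeval_eq_eval])
  have hNij : ∀ i j, algebraMap ℝ K (eval z (N i j)) = aeval x (diffInner B (π i) (π j)) := by
    intro i j
    rw [← hev]
    exact congrArg _ (congrFun (congrFun hN i) j)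
  simp only [dotProduct, mulVec, map_sum, map_mul, Matrix.map_apply, hNij, aeval_diffInner,
    Finset.sum_mul_sum]
  simp only [Finset.mul_sum, Finset.sum_mul]
  rw [sum_sum_comm]
  refine Finset.sum_congr rfl fun _ _ => Finset.sum_congr rfl fun _ _ =>
    Finset.sum_congr rfl fun _ _ => Finset.sum_congr rfl fun _ _ => ?_
  ring

/-- A complex point over a real point `z` at which the Gram matrix is
positive semidefinite is real. -/
theorem star_eq_of_posSemidef [Finite G] (hB : IsInvariantInnerProduct G B)
    (hπ : IsFundamentalInvariants G π)
    {N : Matrix (Fin m) (Fin m) (MvPolynomial (Fin m) ℝ)}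
    (hN : Represents π N (gramMatrix B π)) {x : Fin n → ℂ} {z : Fin m → ℝ}
    (hx : ∀ i, aeval x (π i) = (z i : ℂ)) (hz : (N.map (eval z)).PosSemidef) :
    star x = x := by
  classical
  have := Fintype.ofFinite G
  by_contra hne
  set b : Fin n → ℝ := fun j => (x j).im with hb
  have hdet : IsUnit B.det := hB.1.det_pos.ne'.isUnit
  -- By invariance of `B`, group elements that fix `Im x` fix `l`, and those that negate it negate
  -- `l`.
  set l : Fin n → ℝ := B⁻¹ *ᵥ b with hl
  have hBl : B *ᵥ l = b := by rw [hl, mulVec_mulVec, mul_nonsing_inv _ hdet, one_mulVec]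
  have hl0 : l ≠ 0 := by
    intro h0
    rw [h0, mulVec_zero] at hBl
    refine hne (funext fun j => Complex.ext rfl ?_)
    have : (x j).im = 0 := (congrFun hBl j).symm
    simp [this]
  have hinj : ∀ u v : Fin n → ℝ, B *ᵥ u = B *ᵥ v → u = v := fun u v h => by
    have := congrArg (B⁻¹ *ᵥ ·) h
    simpa [mulVec_mulVec, nonsing_inv_mul _ hdet] using this
  -- invariance of the form `l`
  have hBt : ∀ σ ∈ G, B *ᵥ ((σ⁻¹).val.transpose *ᵥ l) = σ.val *ᵥ b := by
    intro σ hσ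
    have h := hB.2 σ⁻¹ (inv_mem hσ)
    have h2 : B * (σ⁻¹).val.transpose = σ.val * B := by
      conv_rhs => rw [← h]
      rw [← Matrix.mul_assoc, ← Matrix.mul_assoc, ← Units.val_mul]
      simp
    rw [mulVec_mulVec, h2, ← mulVec_mulVec, hBl]
  let act : G → (Fin n → ℂ) := fun σ => ((σ.val)⁻¹).val.map (algebraMap ℝ ℂ) *ᵥ x
  have him : ∀ σ : G, ∀ j, (act σ j).im = (((σ.val)⁻¹).val *ᵥ b) j := by
    intro σ j
    simp [act, mulVec, dotProduct, hb]
  have hcancel : ∀ (σ : G) (v : Fin n → ℝ), ((σ.val)⁻¹).val *ᵥ b = v → σ.val.val *ᵥ v = b := by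
    rintro σ v rfl
    rw [mulVec_mulVec, ← Units.val_mul]
    simp
  obtain ⟨h, h1, h2, h3⟩ := exists_real_aeval_pderiv_eq x (fun j => Complex.I * l j) hne
    (Finset.univ.image act)
  obtain ⟨P, hP⟩ := hπ.exists_aeval_eq (sum_polyAct_mem_invariants G h)
  -- the differential of the invariant `∑ σ, σ h` at `x`
  have hterm : ∀ σ : G, ∃ r : ℝ, 0 ≤ r ∧ (σ = 1 → r = 1) ∧ ∀ j,
      aeval x (pderiv j (polyAct σ.val h)) = Complex.I * ((r * l j : ℝ) : ℂ) := by
    intro σ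
    have hd : ∀ j, aeval x (pderiv j (polyAct σ.val h))
        = ∑ k, (((σ.val)⁻¹).val k j : ℂ) * aeval (act σ) (pderiv k h) := by
      intro j
      simp [pderiv_polyAct, aeval_polyAct, act]
    by_cases hσ1 : act σ = x
    · refine ⟨1, zero_le_one, fun _ => rfl, fun j => ?_⟩
      have hbv : σ.val.val *ᵥ b = b := hcancel σ b (funext fun j => by rw [← him, hσ1])
      have hlv : ((σ.val)⁻¹).val.transpose *ᵥ l = l :=
        hinj _ _ (by rw [hBt _ σ.2, hbv, hBl])
      rw [hd, hσ1]
      simp only [h1]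
      conv_rhs => rw [← hlv]
      simp only [mulVec, dotProduct, Matrix.transpose_apply, one_mul, Complex.ofReal_sum,
        Complex.ofReal_mul, Finset.mul_sum]
      exact Finset.sum_congr rfl fun k _ => by ring
    have hne1 : σ ≠ 1 := by
      rintro rfl
      exact hσ1 (by simp [act])
    -- Here the prescribed differential is `-i l` and transport by `σ` negates `l`; the signs
    -- cancel, so contributions never offset each other.
    by_cases hσ2 : act σ = star x
    · refine ⟨1, zero_le_one, fun _ => rfl, fun j => ?_⟩
      have hbv : σ.val.val *ᵥ (-b) = b := hcancel σ (-b) (funext fun j => by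
        rw [← him, hσ2]; simp [hb])
      have hlv : ((σ.val)⁻¹).val.transpose *ᵥ l = -l :=
        hinj _ _ (by rw [hBt _ σ.2, mulVec_neg, hBl, ← neg_eq_iff_eq_neg, ← mulVec_neg, hbv])
      rw [hd, hσ2]
      simp only [h2]
      have hlj : l j = -(((σ.val)⁻¹).val.transpose *ᵥ l) j := by rw [hlv]; simp
      rw [hlj]
      simp only [mulVec, dotProduct, Matrix.transpose_apply, one_mul, Complex.ofReal_sum,
        Complex.ofReal_mul, Finset.mul_sum, Complex.ofReal_neg, mul_neg, ← Finset.sum_neg_distrib]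
      exact Finset.sum_congr rfl fun k _ => by simp; ring
    · refine ⟨0, le_rfl, fun h => absurd h hne1, fun j => ?_⟩
      rw [hd]
      simp [h3 (act σ) (Finset.mem_image_of_mem _ (Finset.mem_univ _)) hσ1 hσ2]
  choose r hr0 hr1 hr using hterm
  set R : ℝ := ∑ σ, r σ with hR
  have hRpos : 0 < R := Finset.sum_pos' (fun σ _ => hr0 σ) ⟨1, Finset.mem_univ _, by simp [hr1]⟩
  have hdp : ∀ j, aeval x (pderiv j (aeval π P)) = Complex.I * ((R * l j : ℝ) : ℂ) := by
    intro j
    rw [hP, map_sum, map_sum]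
    simp only [hr, hR, Finset.sum_mul, Complex.ofReal_sum, Finset.mul_sum]
  have hchain : ∀ j, aeval x (pderiv j (aeval π P))
      = ∑ i, algebraMap ℝ ℂ (eval z (pderiv i P)) * aeval x (pderiv j (π i)) := by
    intro j
    rw [pderiv_aeval, map_sum]
    refine Finset.sum_congr rfl fun i _ => ?_
    rw [map_mul, ← AlgHom.comp_apply, comp_aeval]
    simp only [hx]
    congr 1
    exact (aeval_algebraMap_apply ℂ z _).trans (by simp [aeval_eq_eval])
  -- The test vector is real because `P` and `z` are, although `x` is not.
  have hquad := hN.algebraMap_dotProduct (K := ℂ) hx (fun i => eval z (pderiv i P))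
  simp only [← hchain, hdp] at hquad
  have hneg : (fun i => eval z (pderiv i P)) ⬝ᵥ (N.map (eval z) *ᵥ fun i => eval z (pderiv i P))
      = -(R ^ 2 * (l ⬝ᵥ (B *ᵥ l))) := by
    apply Complex.ofReal_injective
    refine hquad.trans ?_
    simp only [dotProduct, mulVec, Finset.mul_sum, Complex.ofReal_neg, Complex.ofReal_mul,
      Complex.ofReal_pow, Complex.ofReal_sum, ← Finset.sum_neg_distrib]
    refine Finset.sum_congr rfl fun j _ => Finset.sum_congr rfl fun k _ => ?_
    have := Complex.I_sq
    simp only [Complex.coe_algebraMap]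
    linear_combination ((B j k : ℂ) * R ^ 2 * l j * l k) * this
  have hpos : 0 < l ⬝ᵥ (B *ᵥ l) := by simpa using hB.1.dotProduct_mulVec_pos hl0
  have hnn := hz.dotProduct_mulVec_nonneg (fun i => eval z (pderiv i P))
  simp only [star_trivial] at hnn
  rw [hneg] at hnn
  have : 0 < R ^ 2 * (l ⬝ᵥ (B *ᵥ l)) := by positivity
  linarith

theorem exists_represents_gramMatrix (hB : IsInvariantInnerProduct G B)
    (hπ : IsFundamentalInvariants G π) :
    ∃ N : Matrix (Fin m) (Fin m) (MvPolynomial (Fin m) ℝ), Represents π N (gramMatrix B π) := by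
  have hinv : ∀ i j, diffInner B (π i) (π j) ∈ invariants G := by
    intro i j σ hσ
    rw [← diffInner_polyAct B σ (hB.2 σ⁻¹ (inv_mem hσ)), hπ.mem_invariants i σ hσ,
      hπ.mem_invariants j σ hσ]
  choose N hN using fun i j => hπ.exists_aeval_eq (hinv i j)
  exact ⟨Matrix.of N, Matrix.ext fun i j => hN i j⟩

theorem Represents.posSemidef (hB : B.PosDef)
    {N : Matrix (Fin m) (Fin m) (MvPolynomial (Fin m) ℝ)}
    (hN : Represents π N (gramMatrix B π)) (x : Fin n → ℝ) :
    (N.map (eval (hilbertMap π x))).PosSemidef := by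
  have hx : ∀ i, aeval x (π i) = algebraMap ℝ ℝ (hilbertMap π x i) := fun i => by
    simp [hilbertMap, aeval_eq_eval]
  have hNij : ∀ i j, eval (hilbertMap π x) (N i j) = eval x (diffInner B (π i) (π j)) := by
    intro i j
    have h : aeval π (N i j) = diffInner B (π i) (π j) := congrFun (congrFun hN i) j
    rw [← h, ← coe_aeval_eq_eval x, RingHom.coe_coe, ← AlgHom.comp_apply, comp_aeval,
      aeval_eq_eval]
    rfl
  have hBs : ∀ j k, B k j = B j k := fun j k => by simpa using hB.isHermitian.apply j k
  refine PosSemidef.of_dotProduct_mulVec_nonneg (Matrix.ext fun i j => ?_) fun c => ?_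
  · simp only [conjTranspose_apply, Matrix.map_apply, star_trivial, hNij, diffInner, map_sum]
    rw [Finset.sum_comm]
    refine Finset.sum_congr rfl fun k _ => Finset.sum_congr rfl fun l _ => ?_
    rw [hBs k l, mul_comm (pderiv l (π j))]
  · have h := hN.algebraMap_dotProduct (K := ℝ) hx c
    simp only [Algebra.algebraMap_self, RingHom.id_apply] at h
    rw [star_trivial, h]
    have := hB.posSemidef.dotProduct_mulVec_nonneg
      fun j => ∑ i, c i * aeval x (pderiv j (π i))
    refine this.trans_eq ?_
    simp only [star_trivial, dotProduct, mulVec, Finset.mul_sum (Finset.univ : Finset (Fin n))]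
    exact Finset.sum_congr rfl fun j _ => Finset.sum_congr rfl fun k _ => by ring

end Main

end OrbitSpace

theorem mainTheorem2 {n m : ℕ} (G : Subgroup (Matrix.GeneralLinearGroup (Fin n) ℝ)) [Finite G]
    (B : Matrix (Fin n) (Fin n) ℝ) (hB : OrbitSpace.IsInvariantInnerProduct G B)
    (π : Fin m → MvPolynomial (Fin n) ℝ) (hπ : OrbitSpace.IsFundamentalInvariants G π) :
    (∃ N : Matrix (Fin m) (Fin m) (MvPolynomial (Fin m) ℝ),
      OrbitSpace.Represents π N (OrbitSpace.gramMatrix B π)) ∧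
    ∀ N : Matrix (Fin m) (Fin m) (MvPolynomial (Fin m) ℝ),
      OrbitSpace.Represents π N (OrbitSpace.gramMatrix B π) →
      Set.range (OrbitSpace.hilbertMap π) =
        {z : Fin m → ℝ | z ∈ MvPolynomial.zeroLocus ℝ (OrbitSpace.relationIdeal π) ∧
          (N.map (MvPolynomial.eval z)).PosSemidef} := by
  refine ⟨OrbitSpace.exists_represents_gramMatrix hB hπ, fun N hN => Set.Subset.antisymm ?_ ?_⟩
  · rintro _ ⟨x, rfl⟩
    refine ⟨fun p hp => ?_, hN.posSemidef hB.1 x⟩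
    have hp0 : aeval π p = 0 := hp
    have h := congrArg (aeval x) hp0
    rw [← AlgHom.comp_apply, comp_aeval, map_zero] at h
    simp only [aeval_eq_eval] at h ⊢
    exact h
  · rintro z ⟨hz, hpsd⟩
    obtain ⟨x, hx⟩ := hπ.exists_complex_preimage hz
    have hreal := OrbitSpace.star_eq_of_posSemidef hB hπ hN hx hpsd
    refine ⟨fun j => (x j).re, funext fun i => Complex.ofReal_injective ?_⟩
    rw [← hx i]
    have hxr : x = fun j => algebraMap ℝ ℂ (x j).re := funext fun j =>
      (Complex.conj_eq_iff_re.1 (congrFun hreal j)).symm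
    conv_rhs => rw [hxr]
    exact ((aeval_algebraMap_apply ℂ (fun j => (x j).re) (π i)).trans
      (by simp [aeval_eq_eval, OrbitSpace.hilbertMap])).symm
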